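/- Let $X$ be a base set (i.e. $\emptyset\notin X$ and no element of an $x\in X$ lies in $\mathbb V(X)$), where $\mathbb V(X)=\bigcup_n \mathbb V_n(X)$, $\mathbb V_0(X)=X$, $\mathbb V_{n+1}(X)=\mathbb V_n(X)\cup\wp(\mathbb V_n(X))$ is the superstructure on $X$, and assume that a copy of $\mathbb N=\{0,1,2,\dots\}$ is contained in $X$. Let $*:\mathbb V(X)\to\mathbb V(X)$ be a map such that ${}^*X=X$; ${}^*n=n$ for all $n\in\mathbb N$; $*$ is proper, i.e. $\{{}^*a\mid a\in A\}\subsetneq{}^*A$ for every infinite set $A\in\mathbb V(X)\setminus X$; and $*$ satisfies the transfer principle, i.e. $\mathbb V(X)\models\varphi(a_1,\dots,a_n)$ if and only if $\mathbb V(X)\models\varphi({}^*a_1,\dots,{}^*a_n)$ for every bounded quantifier formula $\varphi$ in the language of set theory and all $a_1,\dots,a_n\in\mathbb V(X)$. (No enlarging or saturation property of $*$ is needed.) Let $S_0=\mathrm{id}$ and $S_{n+1}=*\circ S_n$. For a subset $A$ of $\mathbb N$, of $\mathbb N^2$ or of $\mathbb N^2\times\mathbb N$ (ordered pairs being Kuratowski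 pairs) let ${}^\bullet A=\bigcup_{n\in\mathbb N}S_n(A)$; in particular ${}^\bullet\mathbb N=\bigcup_n S_n(\mathbb N)$ is the $\omega$-hyperextension of $\mathbb N$. For $\alpha,\beta\in{}^\bullet\mathbb N$ let $h(\alpha)$ be the least $m\in\mathbb N$ with $\alpha\in S_m(\mathbb N)$ (so $h(\alpha)=0$ for $\alpha\in\mathbb N$), let $\alpha+\beta$ be the unique $\gamma\in{}^\bullet\mathbb N$ with $((\alpha,\beta),\gamma)\in{}^\bullet\Gamma$, where $\Gamma$ is the graph of the addition of $\mathbb N$, and let $$\mathfrak U_\alpha=\{A\subseteq\mathbb N\mid\alpha\in{}^\bullet A\},\qquad \mathfrak U_{(\alpha,\beta)}=\{A\subseteq\mathbb N^2\mid(\alpha,\beta)\in{}^\bullet A\},$$ which are ultrafilters on $\mathbb N$ and on $\mathbb N^2$. For ultrafilters $\mathcal U,\mathcal V$ on $\mathbb N$ let $$\mathcal U\otimes\mathcal V=\{A\subseteq\mathbb N^2\mid\{n\mid\{m\mid(n,m)\in A\}\in\mathcal V\}\in\mathcal U\},\qquad \mathcal U\oplus\mathcal V=\{A\subseteq\mathbb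 N\mid\{n\mid\{m\mid n+m\in A\}\in\mathcal V\}\in\mathcal U\}.$$ Then, for all $\alpha,\beta\in{}^\bullet\mathbb N$: 1. if there are $k\in\mathbb N$ and $\gamma\in{}^\bullet\mathbb N$ with $\beta=S_{h(\alpha)+k}(\gamma)$, then $(\alpha,\beta)$ is a tensor pair, i.e. $\mathfrak U_{(\alpha,\beta)}=\mathfrak U_\alpha\otimes\mathfrak U_\beta$; 2. $\mathfrak U_{(\alpha,\,S_{h(\alpha)}(\beta))}=\mathfrak U_\alpha\otimes\mathfrak U_\beta$; 3. $\mathfrak U_{\alpha+S_{h(\alpha)}(\beta)}=\mathfrak U_\alpha\oplus\mathfrak U_\beta$. -/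

import Mathlib

universe u

namespace OmegaHyper

/-! ### Superstructures -/

/-- `V_0(X) = X` and `V_{n+1}(X) = V_n(X) ∪ ℘(V_n(X))`. -/
noncomputable def level (X : ZFSet.{u}) : ℕ → ZFSet.{u}
  | 0 => X
  | n + 1 => level X n ∪ ZFSet.powerset (level X n)

/-- The superstructure `V(X)`, the union of all the `V_n(X)`, as a type. -/
def Superstructure (X : ZFSet.{u}) : Type (u + 1) := {a : ZFSet.{u} // ∃ n, a ∈ level X n}

/-- `X` is a base set: its elements are nonempty and have no element in `V(X)`, so that they
behave as atoms within `V(X)`. -/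
def IsBaseSet (X : ZFSet.{u}) : Prop :=
  ∅ ∉ X ∧ ∀ x ∈ X, ∀ y : Superstructure X, y.1 ∉ x

instance (X : ZFSet.{u}) : Membership (Superstructure X) (Superstructure X) :=
  ⟨fun b a => a.1 ∈ b.1⟩

theorem mem_def {X : ZFSet.{u}} {a b : Superstructure X} : a ∈ b ↔ a.1 ∈ b.1 := Iff.rfl

theorem level_mono {X : ZFSet.{u}} {m n : ℕ} (h : m ≤ n) {a : ZFSet.{u}} (ha : a ∈ level X m) :
    a ∈ level X n := by
  induction n, h using Nat.le_induction with
  | base => exact ha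
  | succ n _ ih => exact ZFSet.mem_union.2 (Or.inl ih)

theorem mem_level_succ {X a : ZFSet.{u}} {n : ℕ} (h : ∀ b ∈ a, b ∈ level X n) :
    a ∈ level X (n + 1) :=
  ZFSet.mem_union.2 (Or.inr (ZFSet.mem_powerset.2 fun {_} hb => h _ hb))

theorem level_cases {X a : ZFSet.{u}} {n : ℕ} (h : a ∈ level X n) :
    a ∈ X ∨ ∃ m, ∀ b ∈ a, b ∈ level X m := by
  induction n with
  | zero => exact Or.inl h
  | succ n ih =>
    rcases ZFSet.mem_union.1 h with h | h
    · exact ih h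
    · exact Or.inr ⟨n, fun b hb => ZFSet.mem_powerset.1 h hb⟩

/-- The set `X` as an element of `V(X)`. -/
def base (X : ZFSet.{u}) : Superstructure X := ⟨X, 1, mem_level_succ fun _ hb => hb⟩

theorem pair_mem_level {X a b : ZFSet.{u}} {n : ℕ} (ha : a ∈ level X n) (hb : b ∈ level X n) :
    ZFSet.pair a b ∈ level X (n + 2) := by
  refine mem_level_succ fun c hc => mem_level_succ fun d hd => ?_
  simp only [ZFSet.pair, ZFSet.mem_pair] at hc
  rcases hc with rfl | rfl
  · rw [ZFSet.mem_singleton.1 hd]; exact ha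
  · rcases ZFSet.mem_pair.1 hd with rfl | rfl
    · exact ha
    · exact hb

/-- The (Kuratowski) ordered pair in `V(X)`. -/
noncomputable def opair {X : ZFSet.{u}} (a b : Superstructure X) : Superstructure X :=
  ⟨ZFSet.pair a.1 b.1, by
    obtain ⟨m, hm⟩ := a.2
    obtain ⟨n, hn⟩ := b.2
    exact ⟨max m n + 2, pair_mem_level (level_mono (le_max_left _ _) hm)
      (level_mono (le_max_right _ _) hn)⟩⟩

theorem opair_inj {X : ZFSet.{u}} {a b c d : Superstructure X} :
    opair a b = opair c d ↔ a = c ∧ b = d := by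
  constructor
  · intro h
    have h' := ZFSet.pair_inj.1 (congrArg Subtype.val h)
    exact ⟨Subtype.ext h'.1, Subtype.ext h'.2⟩
  · rintro ⟨rfl, rfl⟩; rfl

/-! ### Bounded quantifier formulas -/

/-- Bounded quantifier formulas of the language of set theory (with equality) in `n` free
variables. In `allMem i φ`, which is `(∀ x ∈ v_i) φ`, and in `exMem i φ`, which is
`(∃ x ∈ v_i) φ`, the bound variable `x` has the index `0` in `φ` and every other index is shifted
by one. -/
inductive BQFormula : ℕ → Type
  | mem {n : ℕ} (i j : Fin n) : BQFormula n
  | eq {n : ℕ} (i j : Fin n) : BQFormula n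
  | not {n : ℕ} (φ : BQFormula n) : BQFormula n
  | and {n : ℕ} (φ ψ : BQFormula n) : BQFormula n
  | or {n : ℕ} (φ ψ : BQFormula n) : BQFormula n
  | imp {n : ℕ} (φ ψ : BQFormula n) : BQFormula n
  | allMem {n : ℕ} (i : Fin n) (φ : BQFormula (n + 1)) : BQFormula n
  | exMem {n : ℕ} (i : Fin n) (φ : BQFormula (n + 1)) : BQFormula n

/-- Truth in `V(X)` of a bounded quantifier formula, with elements of `V(X)` for its free
variables. -/
def BQFormula.Realize {X : ZFSet.{u}} :
    {n : ℕ} → BQFormula n → (Fin n → Superstructure X) → Prop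
  | _, .mem i j, v => v i ∈ v j
  | _, .eq i j, v => v i = v j
  | _, .not φ, v => ¬ φ.Realize v
  | _, .and φ ψ, v => φ.Realize v ∧ ψ.Realize v
  | _, .or φ ψ, v => φ.Realize v ∨ ψ.Realize v
  | _, .imp φ ψ, v => φ.Realize v → ψ.Realize v
  | _, .allMem i φ, v => ∀ x : Superstructure X, x ∈ v i → φ.Realize (Matrix.vecCons x v)
  | _, .exMem i φ, v => ∃ x : Superstructure X, x ∈ v i ∧ φ.Realize (Matrix.vecCons x v)

/-! ### Superstructure models of nonstandard methods -/

/-- A superstructure model of nonstandard methods `⟨V(X), V(X), *⟩`, with a single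
superstructure. -/
structure StarModel (X : ZFSet.{u}) where
  /-- the elements of `X` are atoms of `V(X)` -/
  isBaseSet : IsBaseSet X
  /-- the copy of `ℕ` in `X` -/
  nat : ℕ → Superstructure X
  nat_injective : Function.Injective nat
  nat_mem_base : ∀ n, nat n ∈ base X
  /-- the star map -/
  star : Superstructure X → Superstructure X
  star_base : star (base X) = base X
  /-- the star map is proper: `{*a | a ∈ A}` is properly included in `*A`, for every infinite set
  `A` relative to `V(X)` -/
  proper : ∀ A : Superstructure X, A ∉ base X → {a | a ∈ A}.Infinite →
    star '' {a | a ∈ A} ⊂ {b | b ∈ star A}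
  /-- the transfer principle -/
  transfer : ∀ {n : ℕ} (φ : BQFormula n) (v : Fin n → Superstructure X),
    φ.Realize v ↔ φ.Realize (fun i => star (v i))
  star_nat : ∀ n, star (nat n) = nat n

namespace StarModel

variable {X : ZFSet.{u}} (M : StarModel X)

/-- The iterated star map: `S_0 = id`, `S_{n+1} = * ∘ S_n`. -/
def S (n : ℕ) : Superstructure X → Superstructure X := M.star^[n]

/-- `•A`, the union of the sets `S_n(A)`. -/
def bullet (A : Superstructure X) : Set (Superstructure X) := {x | ∃ n, x ∈ M.S n A}

theorem S_succ (n : ℕ) (a : Superstructure X) : M.S (n + 1) a = M.star (M.S n a) :=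
  Function.iterate_succ_apply' _ _ _

theorem S_succ' (n : ℕ) (a : Superstructure X) : M.S (n + 1) a = M.S n (M.star a) := rfl

theorem S_add (m n : ℕ) (a : Superstructure X) : M.S (m + n) a = M.S m (M.S n a) :=
  Function.iterate_add_apply _ _ _ _

theorem transfer_S (m : ℕ) {n : ℕ} (φ : BQFormula n) (v : Fin n → Superstructure X) :
    φ.Realize v ↔ φ.Realize (fun i => M.S m (v i)) := by
  induction m with
  | zero => exact Iff.rfl
  | succ m ih =>
    rw [ih, M.transfer φ]
    simp only [S_succ]

theorem mem_S (n : ℕ) (a b : Superstructure X) : a ∈ b ↔ M.S n a ∈ M.S n b := by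
  have h := M.transfer_S n (.mem 0 1) ![a, b]
  simp only [BQFormula.Realize] at h
  exact h

theorem subset_S (n : ℕ) (a b : Superstructure X) :
    (∀ x, x ∈ a → x ∈ b) ↔ (∀ x, x ∈ M.S n a → x ∈ M.S n b) := by
  have h := M.transfer_S n (.allMem 0 (.mem 0 2)) ![a, b]
  simp only [BQFormula.Realize] at h
  exact h

theorem inter_S (n : ℕ) (a b c : Superstructure X) :
    (∀ x, x ∈ a → x ∈ b → x ∈ c) ↔ (∀ x, x ∈ M.S n a → x ∈ M.S n b → x ∈ M.S n c) := by
  have h := M.transfer_S n (.allMem 0 (.imp (.mem 0 2) (.mem 0 3))) ![a, b, c]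
  simp only [BQFormula.Realize] at h
  exact h

theorem union_S (n : ℕ) (a b c : Superstructure X) :
    (∀ x, x ∈ a → x ∈ b ∨ x ∈ c) ↔ (∀ x, x ∈ M.S n a → x ∈ M.S n b ∨ x ∈ M.S n c) := by
  have h := M.transfer_S n (.allMem 0 (.or (.mem 0 2) (.mem 0 3))) ![a, b, c]
  simp only [BQFormula.Realize] at h
  exact h

theorem empty_S (n : ℕ) (a : Superstructure X) :
    (∀ x, x ∈ a → ¬ x ∈ a) ↔ (∀ x, x ∈ M.S n a → ¬ x ∈ M.S n a) := by
  have h := M.transfer_S n (.allMem 0 (.not (.mem 0 1))) ![a]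
  simp only [BQFormula.Realize] at h
  exact h

/-- The formula `v_k = (v_i, v_j)`. -/
def pairFormula {n : ℕ} (k i j : Fin n) : BQFormula n :=
  .exMem k (.exMem k.succ (.and
    (.allMem k.succ.succ (.or (.eq 0 1) (.eq 0 2)))
    (.and (.and (.mem i.succ.succ 0) (.allMem 0 (.eq 0 i.succ.succ.succ)))
      (.and (.and (.mem i.succ.succ 1) (.mem j.succ.succ 1))
        (.allMem 1 (.or (.eq 0 i.succ.succ.succ) (.eq 0 j.succ.succ.succ)))))))

/-- A non-atom has all its elements in `V(X)`. -/
theorem lift_mem (M : StarModel X) {a z : Superstructure X} (ha : a ∈ z) {b : ZFSet.{u}} (hb : b ∈ z.1) :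
    ∃ m, b ∈ level X m := by
  obtain ⟨n, hn⟩ := z.2
  rcases level_cases hn with h | ⟨m, hm⟩
  · exact absurd ha (M.isBaseSet.2 _ h a)
  · exact ⟨m, hm b hb⟩

theorem realize_pairFormula (M : StarModel X) {n : ℕ} (k i j : Fin n) (v : Fin n → Superstructure X) :
    (pairFormula k i j).Realize v ↔ v k = opair (v i) (v j) := by
  simp only [pairFormula, BQFormula.Realize]
  change (∃ w, w ∈ v k ∧ ∃ s, s ∈ v k ∧ (∀ t, t ∈ v k → t = s ∨ t = w) ∧
    (v i ∈ s ∧ ∀ t, t ∈ s → t = v i) ∧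
    (v i ∈ w ∧ v j ∈ w) ∧ ∀ t, t ∈ w → t = v i ∨ t = v j) ↔ _
  constructor
  · rintro ⟨w, hw, s, hs, hk, ⟨his, hs'⟩, ⟨hiw, hjw⟩, hw'⟩
    have es : s.1 = {(v i).1} := by
      ext t
      rw [ZFSet.mem_singleton]
      constructor
      · intro ht
        exact congrArg Subtype.val (hs' ⟨t, M.lift_mem his ht⟩ ht)
      · rintro rfl; exact his
    have ew : w.1 = {(v i).1, (v j).1} := by
      ext t
      rw [ZFSet.mem_pair]
      constructor
      · intro ht
        rcases hw' ⟨t, M.lift_mem hiw ht⟩ ht with h | h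
        · exact Or.inl (congrArg Subtype.val h)
        · exact Or.inr (congrArg Subtype.val h)
      · rintro (rfl | rfl)
        · exact hiw
        · exact hjw
    apply Subtype.ext
    change (v k).1 = ({{(v i).1}, {(v i).1, (v j).1}} : ZFSet)
    ext t
    rw [ZFSet.mem_pair, ← es, ← ew]
    constructor
    · intro ht
      rcases hk ⟨t, M.lift_mem hw ht⟩ ht with h | h
      · exact Or.inl (congrArg Subtype.val h)
      · exact Or.inr (congrArg Subtype.val h)
    · rintro (rfl | rfl)
      · exact hs
      · exact hw
  · intro h
    rw [h]
    obtain ⟨p, hp⟩ := (v i).2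
    obtain ⟨q, hq⟩ := (v j).2
    have hp' := level_mono (le_max_left p q) hp
    have hq' := level_mono (le_max_right p q) hq
    refine ⟨⟨{(v i).1, (v j).1}, max p q + 1, mem_level_succ fun b hb => ?_⟩, ?_,
      ⟨{(v i).1}, max p q + 1, mem_level_succ fun b hb => ?_⟩, ?_, ?_, ⟨?_, ?_⟩, ⟨?_, ?_⟩, ?_⟩
    · rcases ZFSet.mem_pair.1 hb with rfl | rfl
      · exact hp'
      · exact hq'
    · exact ZFSet.mem_pair.2 (Or.inr rfl)
    · rw [ZFSet.mem_singleton.1 hb]; exact hp'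
    · exact ZFSet.mem_pair.2 (Or.inl rfl)
    · intro t ht
      rcases ZFSet.mem_pair.1 ht with h | h
      · exact Or.inl (Subtype.ext h)
      · exact Or.inr (Subtype.ext h)
    · exact ZFSet.mem_singleton.2 rfl
    · intro t ht
      exact Subtype.ext (ZFSet.mem_singleton.1 ht)
    · exact ZFSet.mem_pair.2 (Or.inl rfl)
    · exact ZFSet.mem_pair.2 (Or.inr rfl)
    · intro t ht
      rcases ZFSet.mem_pair.1 ht with h | h
      · exact Or.inl (Subtype.ext h)
      · exact Or.inr (Subtype.ext h)

theorem opair_S (n : ℕ) (a b : Superstructure X) :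
    M.S n (opair a b) = opair (M.S n a) (M.S n b) := by
  have h := M.transfer_S n (pairFormula 0 1 2) ![opair a b, a, b]
  rw [M.realize_pairFormula, M.realize_pairFormula] at h
  exact h.1 rfl

theorem exists_pair_S (n : ℕ) (a b c : Superstructure X) :
    (∀ x, x ∈ a → ∃ y, y ∈ b ∧ opair x y ∈ c) ↔
      (∀ x, x ∈ M.S n a → ∃ y, y ∈ M.S n b ∧ opair x y ∈ M.S n c) := by
  have key : ∀ a b c : Superstructure X, (∀ x, x ∈ a → ∃ y, y ∈ b ∧ opair x y ∈ c) ↔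
      (BQFormula.allMem 0 (.exMem 2 (.exMem 4 (pairFormula 0 2 1)))).Realize ![a, b, c] := by
    intro a b c
    simp only [BQFormula.Realize, M.realize_pairFormula]
    change _ ↔ ∀ x, x ∈ a → ∃ y, y ∈ b ∧ ∃ z, z ∈ c ∧ z = opair x y
    simp
  rw [key, key, M.transfer_S n]
  refine iff_of_eq (congrArg _ ?_)
  funext i
  fin_cases i <;> rfl

theorem all_pair_S (n : ℕ) (a b c : Superstructure X) :
    (∀ x, x ∈ a → ∀ y, y ∈ b → opair x y ∈ c) ↔
      (∀ x, x ∈ M.S n a → ∀ y, y ∈ M.S n b → opair x y ∈ M.S n c) := by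
  have key : ∀ a b c : Superstructure X, (∀ x, x ∈ a → ∀ y, y ∈ b → opair x y ∈ c) ↔
      (BQFormula.allMem 0 (.allMem 2 (.exMem 4 (pairFormula 0 2 1)))).Realize ![a, b, c] := by
    intro a b c
    simp only [BQFormula.Realize, M.realize_pairFormula]
    change _ ↔ ∀ x, x ∈ a → ∀ y, y ∈ b → ∃ z, z ∈ c ∧ z = opair x y
    simp
  rw [key, key, M.transfer_S n]
  refine iff_of_eq (congrArg _ ?_)
  funext i
  fin_cases i <;> rfl

theorem unique_pair_S (n : ℕ) (a b c : Superstructure X) :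
    (∀ x, x ∈ a → ∀ y, y ∈ b → ∀ z, z ∈ b → opair x y ∈ c → opair x z ∈ c → y = z) ↔
      (∀ x, x ∈ M.S n a → ∀ y, y ∈ M.S n b → ∀ z, z ∈ M.S n b →
        opair x y ∈ M.S n c → opair x z ∈ M.S n c → y = z) := by
  have key : ∀ a b c : Superstructure X,
      (∀ x, x ∈ a → ∀ y, y ∈ b → ∀ z, z ∈ b → opair x y ∈ c → opair x z ∈ c → y = z) ↔
      (BQFormula.allMem 0 (.allMem 2 (.allMem 3 (.imp (.exMem 5 (pairFormula 0 3 2))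
        (.imp (.exMem 5 (pairFormula 0 3 1)) (.eq 1 0)))))).Realize ![a, b, c] := by
    intro a b c
    simp only [BQFormula.Realize, M.realize_pairFormula]
    change _ ↔ ∀ x, x ∈ a → ∀ y, y ∈ b → ∀ z, z ∈ b → (∃ w, w ∈ c ∧ w = opair x y) →
      (∃ w, w ∈ c ∧ w = opair x z) → y = z
    simp
  rw [key, key, M.transfer_S n]
  refine iff_of_eq (congrArg _ ?_)
  funext i
  fin_cases i <;> rfl

/-! ### `ℕ`, its finite powers and their subsets inside `V(X)` -/

/-- A copy of the countable set `I` inside `V(X)`, with all its points fixed by the star map. Only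
the copies `natCopy` of `ℕ` and `Copy.prod` of products are used. -/
structure Copy (I : Type) where
  pt : I → Superstructure X
  pt_injective : Function.Injective pt
  bounded : ∃ n, ∀ i, (pt i).1 ∈ level X n
  star_pt : ∀ i, M.star (pt i) = pt i

/-- The copy of `ℕ` that the model comes with. -/
def natCopy : M.Copy ℕ where
  pt := M.nat
  pt_injective := M.nat_injective
  bounded := ⟨0, M.nat_mem_base⟩
  star_pt := M.star_nat

variable {M} {I J : Type}

/-- The copy of `I × J` whose points are the ordered pairs. -/
noncomputable def Copy.prod (c : M.Copy I) (d : M.Copy J) : M.Copy (I × J) where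
  pt p := opair (c.pt p.1) (d.pt p.2)
  pt_injective p q h := by
    have h' := opair_inj.1 h
    exact Prod.ext (c.pt_injective h'.1) (d.pt_injective h'.2)
  bounded := by
    obtain ⟨m, hm⟩ := c.bounded
    obtain ⟨n, hn⟩ := d.bounded
    exact ⟨max m n + 2, fun p => pair_mem_level (level_mono (le_max_left _ _) (hm _))
      (level_mono (le_max_right _ _) (hn _))⟩
  star_pt p := by
    have h := M.opair_S 1 (c.pt p.1) (d.pt p.2)
    change M.star _ = opair (M.star _) (M.star _) at h
    rw [h, c.star_pt, d.star_pt]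

/-- The set `{pt i | i ∈ A}` as an element of `V(X)`. -/
noncomputable def Copy.set (c : M.Copy I) (A : Set I) : Superstructure X :=
  ⟨ZFSet.range fun i : A => (c.pt i.1).1, by
    obtain ⟨n, hn⟩ := c.bounded
    refine ⟨n + 1, mem_level_succ fun b hb => ?_⟩
    obtain ⟨i, rfl⟩ := ZFSet.mem_range.1 hb
    exact hn _⟩

theorem Copy.mem_set (c : M.Copy I) {A : Set I} {x : Superstructure X} :
    x ∈ c.set A ↔ ∃ i ∈ A, c.pt i = x := by
  refine ZFSet.mem_range.trans ⟨?_, ?_⟩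
  · rintro ⟨i, hi⟩
    exact ⟨i.1, i.2, Subtype.ext hi⟩
  · rintro ⟨i, hi, rfl⟩
    exact ⟨⟨i, hi⟩, rfl⟩

theorem Copy.pt_mem_set (c : M.Copy I) {A : Set I} {i : I} : c.pt i ∈ c.set A ↔ i ∈ A := by
  rw [c.mem_set]
  constructor
  · rintro ⟨j, hj, h⟩
    rwa [← c.pt_injective h]
  · exact fun h => ⟨i, h, rfl⟩

/-- `S_m(A) ⊆ S_n(A)` for `m ≤ n`. -/
theorem Copy.S_mono (c : M.Copy I) (A : Set I) {m n : ℕ} (h : m ≤ n) {x : Superstructure X}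
    (hx : x ∈ M.S m (c.set A)) : x ∈ M.S n (c.set A) := by
  induction n, h using Nat.le_induction with
  | base => exact hx
  | succ n _ ih =>
    rw [M.S_succ']
    refine (M.subset_S n _ _).1 ?_ x ih
    intro y hy
    obtain ⟨i, hi, rfl⟩ := c.mem_set.1 hy
    have := (M.mem_S 1 _ _).1 hy
    change M.star _ ∈ M.star _ at this
    rwa [c.star_pt] at this

/-- The ultrafilter `{A ⊆ I | α ∈ •A}` generated by an element `α` of `•I`. -/
noncomputable def Copy.ultrafilter (c : M.Copy I) (α : Superstructure X)
    (hα : α ∈ M.bullet (c.set Set.univ)) : Ultrafilter I :=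
  Ultrafilter.ofComplNotMemIff
    { sets := {A | α ∈ M.bullet (c.set A)}
      univ_sets := hα
      sets_of_superset := by
        rintro A B ⟨n, hn⟩ hAB
        refine ⟨n, (M.subset_S n _ _).1 ?_ α hn⟩
        intro y hy
        obtain ⟨i, hi, rfl⟩ := c.mem_set.1 hy
        exact c.pt_mem_set.2 (hAB hi)
      inter_sets := by
        rintro A B ⟨m, hm⟩ ⟨n, hn⟩
        refine ⟨max m n, (M.inter_S _ (c.set A) (c.set B) _).1 ?_ α
          (c.S_mono A (le_max_left _ _) hm) (c.S_mono B (le_max_right _ _) hn)⟩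
        intro y hy hy'
        obtain ⟨i, hi, rfl⟩ := c.mem_set.1 hy
        exact c.pt_mem_set.2 ⟨hi, c.pt_mem_set.1 hy'⟩ }
    (by
      intro A
      change ¬ (α ∈ M.bullet (c.set Aᶜ)) ↔ α ∈ M.bullet (c.set A)
      constructor
      · intro h
        obtain ⟨n, hn⟩ := hα
        rcases (M.union_S n (c.set Set.univ) (c.set A) (c.set Aᶜ)).1 (by
          intro y hy
          obtain ⟨i, -, rfl⟩ := c.mem_set.1 hy
          rw [c.pt_mem_set, c.pt_mem_set]
          exact em _) α hn with h1 | h1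
        · exact ⟨n, h1⟩
        · exact absurd ⟨n, h1⟩ h
      · rintro ⟨m, hm⟩ ⟨n, hn⟩
        have h1 := (M.inter_S (max m n) (c.set A) (c.set Aᶜ) (c.set ∅)).1 (by
          intro y hy hy'
          obtain ⟨i, hi, rfl⟩ := c.mem_set.1 hy
          exact absurd hi (c.pt_mem_set.1 hy')) α
            (c.S_mono A (le_max_left _ _) hm) (c.S_mono Aᶜ (le_max_right _ _) hn)
        exact (M.empty_S (max m n) (c.set ∅)).1 (by
          intro y hy
          obtain ⟨i, hi, rfl⟩ := c.mem_set.1 hy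
          exact absurd hi (Set.notMem_empty i)) α h1 h1)

theorem Copy.mem_ultrafilter (c : M.Copy I) (α : Superstructure X)
    (hα : α ∈ M.bullet (c.set Set.univ)) (A : Set I) :
    A ∈ c.ultrafilter α hα ↔ α ∈ M.bullet (c.set A) := Iff.rfl

theorem Copy.opair_mem (c : M.Copy I) (d : M.Copy J) {α β : Superstructure X}
    (hα : α ∈ M.bullet (c.set Set.univ)) (hβ : β ∈ M.bullet (d.set Set.univ)) :
    opair α β ∈ M.bullet ((c.prod d).set Set.univ) := by
  obtain ⟨m, hm⟩ := hα
  obtain ⟨n, hn⟩ := hβ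
  refine ⟨max m n, (M.all_pair_S _ (c.set Set.univ) (d.set Set.univ) _).1 ?_ _
    (c.S_mono _ (le_max_left _ _) hm) _ (d.S_mono _ (le_max_right _ _) hn)⟩
  intro x hx y hy
  obtain ⟨i, -, rfl⟩ := c.mem_set.1 hx
  obtain ⟨j, -, rfl⟩ := d.mem_set.1 hy
  exact (c.prod d).mem_set.2 ⟨(i, j), trivial, rfl⟩

/-- For `f : I → J`, the set `•Γ_f` is the graph of a function `•f : •I → •J`. -/
theorem Copy.existsUnique_map (c : M.Copy I) (d : M.Copy J) (f : I → J) {α : Superstructure X}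
    (hα : α ∈ M.bullet (c.set Set.univ)) :
    ∃! γ : Superstructure X, γ ∈ M.bullet (d.set Set.univ) ∧
      opair α γ ∈ M.bullet ((c.prod d).set {p | f p.1 = p.2}) := by
  obtain ⟨m, hm⟩ := hα
  obtain ⟨γ, h1, h2⟩ := (M.exists_pair_S m (c.set Set.univ) (d.set Set.univ)
    ((c.prod d).set {p | f p.1 = p.2})).1 (by
      intro x hx
      obtain ⟨i, -, rfl⟩ := c.mem_set.1 hx
      exact ⟨d.pt (f i), d.pt_mem_set.2 trivial,
        (c.prod d).mem_set.2 ⟨(i, f i), rfl, rfl⟩⟩) α hm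
  refine ⟨γ, ⟨⟨m, h1⟩, ⟨m, h2⟩⟩, ?_⟩
  rintro δ ⟨⟨n, hn⟩, ⟨k, hk⟩⟩
  have l1 : m ≤ max m (max n k) := le_max_left _ _
  have l2 : n ≤ max m (max n k) := (le_max_left _ _).trans (le_max_right _ _)
  have l3 : k ≤ max m (max n k) := (le_max_right _ _).trans (le_max_right _ _)
  refine (M.unique_pair_S (max m (max n k)) (c.set Set.univ) (d.set Set.univ)
    ((c.prod d).set {p | f p.1 = p.2})).1 ?_ α (c.S_mono _ l1 hm) δ (d.S_mono _ l2 hn) γ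
      (d.S_mono _ l1 h1) ((c.prod d).S_mono _ l3 hk) ((c.prod d).S_mono _ l1 h2)
  intro x hx y hy z hz hxy hxz
  obtain ⟨i, -, rfl⟩ := c.mem_set.1 hx
  obtain ⟨j, -, rfl⟩ := d.mem_set.1 hy
  obtain ⟨k, -, rfl⟩ := d.mem_set.1 hz
  have e1 : f i = j := (c.prod d).pt_mem_set (i := (i, j)).1 hxy
  have e2 : f i = k := (c.prod d).pt_mem_set (i := (i, k)).1 hxz
  rw [← e1, ← e2]

variable (M)

/-! ### The `ω`-hyperextension of `ℕ` -/

/-- The `ω`-hyperextension `•ℕ`, the union of the sets `S_n(ℕ)`. -/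
def HyperNat : Type (u + 1) :=
  {α : Superstructure X // α ∈ M.bullet (M.natCopy.set Set.univ)}

/-- The map `S_n` restricted to `•ℕ`. -/
def starIter (n : ℕ) (α : M.HyperNat) : M.HyperNat :=
  ⟨M.S n α.1, by
    obtain ⟨m, hm⟩ := α.2
    refine ⟨n + m, ?_⟩
    rw [M.S_add]
    exact (M.mem_S n _ _).1 hm⟩

/-- The height of `α`: the least `m` such that `α ∈ S_m(ℕ)`. -/
noncomputable def height (α : M.HyperNat) : ℕ :=
  sInf {m | α.1 ∈ M.S m (M.natCopy.set Set.univ)}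

/-- `𝔘_α = {A ⊆ ℕ | α ∈ •A}`. -/
noncomputable def ultra (α : M.HyperNat) : Ultrafilter ℕ := M.natCopy.ultrafilter α.1 α.2

/-- `𝔘_{(α, β)} = {A ⊆ ℕ² | (α, β) ∈ •A}`. -/
noncomputable def ultraPair (α β : M.HyperNat) : Ultrafilter (ℕ × ℕ) :=
  (M.natCopy.prod M.natCopy).ultrafilter (opair α.1 β.1) (M.natCopy.opair_mem M.natCopy α.2 β.2)

/-- The sum `α + β` in `•ℕ`: the value at `(α, β)` of the extension to `•ℕ` of the addition
of `ℕ`, whose graph is `•Γ` for the graph `Γ` of the addition of `ℕ`. -/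
noncomputable def hyperAdd (α β : M.HyperNat) : M.HyperNat :=
  have h := (M.natCopy.prod M.natCopy).existsUnique_map M.natCopy (fun p : ℕ × ℕ => p.1 + p.2)
    (M.natCopy.opair_mem M.natCopy α.2 β.2)
  ⟨h.choose, h.choose_spec.1.1⟩

/-- The relation `R`: `β = S_{h(α)+k}(γ)` for some natural number `k` and some `γ` in `•ℕ`. -/
def R (α β : M.HyperNat) : Prop :=
  ∃ (k : ℕ) (γ : M.HyperNat), β = M.starIter (M.height α + k) γ

end StarModel

/-! ### Tensor products and sums of ultrafilters -/

/-- The tensor product `𝒰 ⊗ 𝒱` of two ultrafilters on `ℕ`. -/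
def tensor (U V : Ultrafilter ℕ) : Ultrafilter (ℕ × ℕ) := U.bind fun n => V.map (Prod.mk n)

theorem mem_tensor (U V : Ultrafilter ℕ) (A : Set (ℕ × ℕ)) :
    A ∈ tensor U V ↔ {n | {m | (n, m) ∈ A} ∈ V} ∈ U := Iff.rfl

/-- The sum `𝒰 ⊕ 𝒱` of two ultrafilters on `ℕ` (which is Mathlib's). -/
def oplus (U V : Ultrafilter ℕ) : Ultrafilter ℕ := (Ultrafilter.add (M := ℕ)).add U V

theorem mem_oplus (U V : Ultrafilter ℕ) (A : Set ℕ) :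
    A ∈ oplus U V ↔ {n | {m | n + m ∈ A} ∈ V} ∈ U :=
  Ultrafilter.eventually_add U V (· ∈ A)

/-- `(α, β)` is a tensor pair: `𝔘_{(α, β)} = 𝔘_α ⊗ 𝔘_β`. -/
def StarModel.IsTensorPair {X : ZFSet.{u}} (M : StarModel X) (α β : M.HyperNat) : Prop :=
  M.ultraPair α β = tensor (M.ultra α) (M.ultra β)

end OmegaHyper

/-!
An element `δ ∈ S_N(ℕ)` belongs to `•C` exactly when it belongs to `S_N(C)`, so the set of all
`C` in `𝔘_δ` is decided at one level. Given `A ⊆ ℕ²` with sections `A_n`, put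
`B = {n | A_n ∈ 𝔘_δ}`. Since natural numbers are fixed by `S_N`, every `n ∈ B` has
`(n, δ) ∈ S_N(A)` (`opair_mem_S_of_section`). The statement "`(x, δ) ∈ S_N(A)` for all `x ∈ B`"
transfers along `S_h` to "`(x, S_h(δ)) ∈ S_{h+N}(A)` for all `x ∈ S_h(B)`". If `α ∈ S_h(ℕ)`, then
`B ∈ 𝔘_α` means `α ∈ S_h(B)`, so `(α, S_h(δ)) ∈ •A`. Hence `𝔘_α ⊗ 𝔘_δ ⊆ 𝔘_{(α, S_h(δ))}`, and an
inclusion between ultrafilters is an equality. As `𝔘_{S_h(δ)} = 𝔘_δ` (`ultra_starIter`), this gives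
the tensor pairs (`ultraPair_starIter`); sums follow because `𝔘_{α+β}` is the image of
`𝔘_{(α, β)}` under addition (`ultra_hyperAdd`).
-/

namespace OmegaHyper

namespace StarModel

variable {X : ZFSet.{u}} {M : StarModel X} {I J : Type}

/-- Whether a point of `S_m(I)` lies in `•A` is decided at level `m`. -/
theorem Copy.mem_S_of_mem_bullet (c : M.Copy I) {A : Set I} {α : Superstructure X} {m : ℕ}
    (hm : α ∈ M.S m (c.set Set.univ)) (hA : α ∈ M.bullet (c.set A)) : α ∈ M.S m (c.set A) := by
  have hα : α ∈ M.bullet (c.set Set.univ) := ⟨m, hm⟩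
  refine ((M.union_S m (c.set Set.univ) (c.set A) (c.set Aᶜ)).1 (fun y hy => ?_) α hm).resolve_right
    fun h => ?_
  · obtain ⟨i, -, rfl⟩ := c.mem_set.1 hy
    rw [c.pt_mem_set, c.pt_mem_set]
    exact em _
  · have h' : Aᶜ ∈ c.ultrafilter α hα := ⟨m, h⟩
    exact Ultrafilter.compl_mem_iff_notMem.1 h' hA

theorem Copy.S_pt (c : M.Copy I) (n : ℕ) (i : I) : M.S n (c.pt i) = c.pt i :=
  Function.iterate_fixed (c.star_pt i) n

theorem Copy.opair_mem_S_of_section (c : M.Copy I) (d : M.Copy J) {A : Set (I × J)} {i : I}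
    {N : ℕ} {δ : Superstructure X} (h : δ ∈ M.S N (d.set {j | (i, j) ∈ A})) :
    opair (c.pt i) δ ∈ M.S N ((c.prod d).set A) := by
  refine (M.all_pair_S N (c.set {i}) (d.set {j | (i, j) ∈ A}) ((c.prod d).set A)).1 ?_ _ ?_ _ h
  · intro x hx y hy
    obtain ⟨_, rfl, rfl⟩ := c.mem_set.1 hx
    obtain ⟨j, hj, rfl⟩ := d.mem_set.1 hy
    exact (c.prod d).mem_set.2 ⟨(_, j), hj, rfl⟩
  · rw [← c.S_pt N i]
    exact (M.mem_S N _ _).1 (c.pt_mem_set.2 rfl)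

/-- Transfer along `S_h` of a statement about all `x ∈ a` with the parameter `δ`. -/
theorem opair_S_mem_S {h : ℕ} {a c δ x : Superstructure X} (H : ∀ y, y ∈ a → opair y δ ∈ c)
    (hx : x ∈ M.S h a) : opair x (M.S h δ) ∈ M.S h c := by
  let s : Superstructure X := ⟨{δ.1}, by
    obtain ⟨n, hn⟩ := δ.2
    exact ⟨n + 1, mem_level_succ fun b hb => by rwa [ZFSet.mem_singleton.1 hb]⟩⟩
  refine (M.all_pair_S h a s c).1 (fun y hy z hz => ?_) x hx _
    ((M.mem_S h δ s).1 (ZFSet.mem_singleton.2 rfl))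
  rw [show z = δ from Subtype.ext (ZFSet.mem_singleton.1 hz)]
  exact H y hy

variable (M)

theorem mem_S_height (α : M.HyperNat) : α.1 ∈ M.S (M.height α) (M.natCopy.set Set.univ) :=
  Nat.sInf_mem (s := {m | α.1 ∈ M.S m (M.natCopy.set Set.univ)}) α.2

theorem starIter_add (m n : ℕ) (α : M.HyperNat) :
    M.starIter (m + n) α = M.starIter m (M.starIter n α) :=
  Subtype.ext (M.S_add m n α.1)

/-- Applying `S_n` does not change the ultrafilter generated by a point. -/
theorem ultra_starIter (n : ℕ) (α : M.HyperNat) : M.ultra (M.starIter n α) = M.ultra α := by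
  refine Ultrafilter.eq_of_le fun A hA => ?_
  obtain ⟨m, hm⟩ := hA
  refine ⟨n + m, ?_⟩
  rw [M.S_add]
  exact (M.mem_S n _ _).1 hm

/-- Any level `h` with `α ∈ S_h(ℕ)` makes `(α, S_h(β))` a tensor pair. -/
theorem ultraPair_starIter {h : ℕ} {α : M.HyperNat}
    (hα : α.1 ∈ M.S h (M.natCopy.set Set.univ)) (β : M.HyperNat) :
    M.ultraPair α (M.starIter h β) = tensor (M.ultra α) (M.ultra β) := by
  refine Ultrafilter.eq_of_le fun A hA => ?_
  obtain ⟨N, hN⟩ := β.2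
  refine ⟨h + N, ?_⟩
  rw [M.S_add]
  refine opair_S_mem_S (fun y hy => ?_) (M.natCopy.mem_S_of_mem_bullet hα ((mem_tensor _ _ A).1 hA))
  obtain ⟨n, hn, rfl⟩ := M.natCopy.mem_set.1 hy
  exact M.natCopy.opair_mem_S_of_section _ (M.natCopy.mem_S_of_mem_bullet hN hn)

/-- `𝔘_{α+β}` is the image of `𝔘_{(α, β)}` under the addition of `ℕ`. -/
theorem ultra_hyperAdd (α β : M.HyperNat) :
    M.ultra (M.hyperAdd α β) = (M.ultraPair α β).map fun p => p.1 + p.2 := by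
  refine Ultrafilter.eq_of_le fun A hA => ?_
  obtain ⟨n, hn⟩ := hA
  have hu := (M.natCopy.prod M.natCopy).existsUnique_map M.natCopy (fun p : ℕ × ℕ => p.1 + p.2)
    (M.natCopy.opair_mem M.natCopy α.2 β.2)
  -- Transferring the existence of sums in `A` gives a value in `•A`, which uniqueness identifies
  -- with `α + β`.
  obtain ⟨γ, hγ, hγ'⟩ := (M.exists_pair_S n _ (M.natCopy.set A)
    (((M.natCopy.prod M.natCopy).prod M.natCopy).set {p | p.1.1 + p.1.2 = p.2})).1
    (fun x hx => by
      obtain ⟨p, hp, rfl⟩ := (M.natCopy.prod M.natCopy).mem_set.1 hx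
      exact ⟨M.nat (p.1 + p.2), M.natCopy.pt_mem_set.2 hp,
        ((M.natCopy.prod M.natCopy).prod M.natCopy).mem_set.2 ⟨(p, p.1 + p.2), rfl, rfl⟩⟩) _ hn
  have hγA : γ ∈ M.bullet (M.natCopy.set A) := ⟨n, hγ⟩
  have hγU : γ ∈ M.bullet (M.natCopy.set Set.univ) :=
    ⟨n, (M.subset_S n (M.natCopy.set A) _).1 (fun y hy => by
      obtain ⟨i, -, rfl⟩ := M.natCopy.mem_set.1 hy
      exact M.natCopy.pt_mem_set.2 trivial) γ hγ⟩
  have e : (M.hyperAdd α β).1 = γ := hu.unique hu.choose_spec.1 ⟨hγU, ⟨n, hγ'⟩⟩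
  change (M.hyperAdd α β).1 ∈ M.bullet (M.natCopy.set A)
  rwa [e]

end StarModel

theorem map_add_tensor (U V : Ultrafilter ℕ) :
    (tensor U V).map (fun p => p.1 + p.2) = oplus U V :=
  Ultrafilter.ext fun A => (mem_oplus U V A).symm

end OmegaHyper

theorem theorem2p5p16 {X : ZFSet.{u}} (M : OmegaHyper.StarModel X) :
    (∀ α β : M.HyperNat, M.R α β → M.IsTensorPair α β) ∧
    (∀ α β : M.HyperNat,
      M.ultraPair α (M.starIter (M.height α) β) = OmegaHyper.tensor (M.ultra α) (M.ultra β)) ∧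
    (∀ α β : M.HyperNat,
      M.ultra (M.hyperAdd α (M.starIter (M.height α) β)) =
        OmegaHyper.oplus (M.ultra α) (M.ultra β)) := by
  refine ⟨?_, fun α β => M.ultraPair_starIter (M.mem_S_height α) β, fun α β => ?_⟩
  · rintro α _ ⟨k, γ, rfl⟩
    rw [OmegaHyper.StarModel.IsTensorPair, M.starIter_add,
      M.ultraPair_starIter (M.mem_S_height α), M.ultra_starIter, M.ultra_starIter,
      M.ultra_starIter]
  · rw [M.ultra_hyperAdd, M.ultraPair_starIter (M.mem_S_height α), OmegaHyper.map_add_tensor]
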